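/- Let $A$ be a finite alphabet and let $\mu$ be a positive Bernoulli measure on $A^\omega$, given by a distribution $\mu:A\to(0,1]$ with $\sum_{a\in A}\mu(a)=1$; for a word $w=a_0\cdots a_{k-1}$ put $\mu(w)=\prod_{j<k}\mu(a_j)$. A sequence $X\in A^\omega$ is \emph{$\mu$-normal} if for every finite word $w$ the frequency of (possibly overlapping) occurrences of $w$ in the prefix of $X$ of length $n$, that is, the number of occurrences divided by $n-|w|+1$, converges to $\mu(w)$ as $n\to\infty$. A \emph{probabilistic $\mu$-gambler} $\mathcal G=(Q,A,q_I,\delta,\gamma)$ consists of a finite set $Q$ of states, an initial state $q_I\in Q$, a transition function $\delta$ that assigns to each $(q,a)\in Q\times A$ a probability distribution $\delta(q,a)$ on $Q$, and a betting function $\gamma:Q\times A\to[0,\infty)$ with $\sum_{a\in A}\mu(a)\gamma(q,a)=1$ for every $q\in Q$. Let $(\delta_n(q,a))_{n\in\mathbb N,\,q\in Q,\,a\in A}$ be independent random variables, $\delta_n(q,a)$ having distribution $\delta(q,a)$. The run of $\mathcal G$ on $X$ is the random sequence of states $q_0=q_I$, $q_{n+1}=\delta_n(q_n,X(n))$, and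 the capital of $\mathcal G$ is the random sequence $C_0=1$, $C_{n+1}=C_n\cdot\gamma(q_n,X(n))$. \textbf{Theorem} (Schnorr--Stimm dichotomy theorem for probabilistic finite automata). Let $X\in A^\omega$ and let $\mu$ be a positive Bernoulli measure. (i) If $X$ is $\mu$-normal and $\mathcal G$ is a probabilistic $\mu$-gambler, then almost surely the capital $(C_n)$ of $\mathcal G$ on $X$ is ultimately constant or decreases at an exponential rate, i.e. $\limsup_{n\to\infty}\frac{\log C_n}{n}<0$. (ii) If $X$ is not $\mu$-normal, then there exists a probabilistic $\mu$-gambler that almost surely wins against $X$ at an infinitely often exponential rate, i.e. almost surely $\limsup_{n\to\infty}\frac{\log C_n}{n}>0$. (Here $\log 0=-\infty$.) -/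

import Mathlib

open MeasureTheory Filter Topology
open scoped NNReal ENNReal

universe u v

/-- The prefix `X(0) X(1) … X(n-1)` of length `n` of the infinite sequence `X`. -/
def seqPrefix {A : Type u} (X : ℕ → A) (n : ℕ) : List A :=
  (List.range n).map X

/-- Number of (possibly overlapping) occurrences of the word `x` in the word `w`, that is, the
number of positions `0 ≤ i ≤ |w| - |x|` at which `x` is read in `w`. It is `0` if `|x| > |w|`. -/
def nbOcc {A : Type u} [DecidableEq A] (x w : List A) : ℕ :=
  ((Finset.range (w.length - x.length + 1)).filter
    (fun i => (w.drop i).take x.length = x)).card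

/-- Frequency of occurrence of `x` in `w` (meaningful when `|x| ≤ |w|`). -/
noncomputable def wordFreq {A : Type u} [DecidableEq A] (x w : List A) : ℝ :=
  (nbOcc x w : ℝ) / ((w.length : ℝ) - (x.length : ℝ) + 1)

/-- `μ(w)`: the product of the probabilities of the letters of `w`. -/
def wordProb {A : Type u} (μ : A → ℝ) (w : List A) : ℝ :=
  (w.map μ).prod

/-- `X` is `μ`-normal: every finite word `w` has an asymptotic frequency in `X`, equal to `μ(w)`. -/
def IsNormalSeq {A : Type u} [DecidableEq A] (μ : A → ℝ) (X : ℕ → A) : Prop :=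
  ∀ w : List A, Tendsto (fun n => wordFreq w (seqPrefix X n)) atTop (𝓝 (wordProb μ w))

/-- A probabilistic `μ`-gambler: a probabilistic finite automaton together with a betting
function that satisfies the `μ`-fairness condition in every state. -/
structure ProbGambler (A : Type u) [Fintype A] (μ : A → ℝ) where
  State : Type v
  finState : Finite State
  init : State
  trans : State → A → PMF State
  bet : State → A → ℝ≥0
  fair : ∀ q, ∑ a, μ a * (bet q a : ℝ) = 1

namespace ProbGambler

variable {A : Type u} [Fintype A] {μ : A → ℝ}

/-- The finite state space carries the discrete sigma-algebra. -/
instance (G : ProbGambler.{u, v} A μ) : MeasurableSpace G.State := ⊤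

/-- Sample space of the random choices of `G`: the coordinate `ω (n, r, b)` is the state that `G`
moves to if it is in state `r` when it reads letter number `n` and that letter is `b`. -/
abbrev Choices (G : ProbGambler.{u, v} A μ) : Type (max u v) := ℕ × G.State × A → G.State

/-- Law of the random choices: all the `ω (n, r, b)` are independent, and `ω (n, r, b)` has
distribution `trans r b`. -/
noncomputable def choiceMeasure (G : ProbGambler.{u, v} A μ) : Measure G.Choices :=
  Measure.infinitePi (fun i : ℕ × G.State × A => (G.trans i.2.1 i.2.2).toMeasure)

/-- The state reached after reading the first `n` letters of `X`. -/
def stateAt (G : ProbGambler.{u, v} A μ) (X : ℕ → A) (ω : G.Choices) : ℕ → G.State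
  | 0 => G.init
  | n + 1 => ω (n, G.stateAt X ω n, X n)

/-- The capital after reading the first `n` letters of `X`, with initial capital `1`. -/
noncomputable def capital (G : ProbGambler.{u, v} A μ) (X : ℕ → A) (ω : G.Choices) : ℕ → ℝ≥0
  | 0 => 1
  | n + 1 => G.capital X ω n * G.bet (G.stateAt X ω n) (X n)

end ProbGambler

/-- The sequence takes one and the same value from some index on. -/
def UltimatelyConstant (c : ℕ → ℝ≥0) : Prop :=
  ∃ x : ℝ≥0, ∀ᶠ n in atTop, c n = x

/-- `limsup (log c(n)) / n` as an extended real number, where `log 0 = -∞`. -/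
noncomputable def upperLogRate (c : ℕ → ℝ≥0) : EReal :=
  limsup (fun n : ℕ => ENNReal.log (c n : ℝ≥0∞) / (n : EReal)) atTop

/-- `c` decreases at an exponential rate: `limsup (log c(n)) / n < 0`, that is, there is `ε > 0`
with `c n ≤ exp (-ε n)` for all large `n`. -/
def DecreasesExponentially (c : ℕ → ℝ≥0) : Prop :=
  upperLogRate c < 0

/-- `c` grows at an infinitely often exponential rate: `limsup (log c(n)) / n > 0`, that is,
there is `ε > 0` with `c n ≥ exp (ε n)` for infinitely many `n`. -/
def GrowsExponentiallyIO (c : ℕ → ℝ≥0) : Prop :=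
  0 < upperLogRate c

/-! Normal sequences: fairness makes the mean of the capital factor equal to 1, which gives no
decay, but the μ-mean of its square root is at most 1, with equality only if every bet is 1
(`sum_sq_sqrtBet_sub_one`). So the mean transition matrix P weighted by square roots of bets is
substochastic. A state is safe if no power of P loses mass there; a run that enters a safe state
stays among safe states and its capital is frozen. If the weights of safe states are set to 0, mass
is lost from every state, so the powers of the killed matrix tend to 0
(`tendsto_pow_mulVec_one_zero`) and words of some length k have mean total weight below 1.
Independence turns the expected weight of the run on X into an actual matrix product along X
(`lintegral_runWeight_mul`), and normality with the AM-GM inequality makes this product decay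
exponentially (`IsNormalSeq.exists_le_mul_pow`). Summing expectations makes the decay almost sure.

Non-normal sequences: after some word v some letter a has the wrong conditional frequency. A small
fixed bet on or against a after each v gains linearly in θ and loses only quadratically, so it wins
infinitely often. The gambler is deterministic. -/

/-! ### Factors of a sequence and normality -/

section Factors

variable {A : Type u}

/-- The factor `X(i) X(i+1) … X(i+k-1)` of the infinite sequence `X`. -/
def seqFactor (X : ℕ → A) (i k : ℕ) : List A :=
  (List.range' i k).map X

@[simp] theorem length_seqFactor (X : ℕ → A) (i k : ℕ) : (seqFactor X i k).length = k := by
  simp [seqFactor]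

theorem seqPrefix_eq_seqFactor (X : ℕ → A) (n : ℕ) : seqPrefix X n = seqFactor X 0 n := by
  simp [seqPrefix, seqFactor, List.range_eq_range']

theorem seqFactor_add (X : ℕ → A) (i m n : ℕ) :
    seqFactor X i (m + n) = seqFactor X i m ++ seqFactor X (i + m) n := by
  simp [seqFactor, ← List.map_append]

theorem seqFactor_succ (X : ℕ → A) (i k : ℕ) :
    seqFactor X i (k + 1) = seqFactor X i k ++ [X (i + k)] := by
  rw [seqFactor_add]
  simp [seqFactor]

theorem seqPrefix_add (X : ℕ → A) (m n : ℕ) :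
    seqPrefix X (m + n) = seqPrefix X m ++ seqFactor X m n := by
  simp [seqPrefix_eq_seqFactor, seqFactor_add]

theorem seqPrefix_succ (X : ℕ → A) (n : ℕ) : seqPrefix X (n + 1) = seqPrefix X n ++ [X n] := by
  simp [seqPrefix, List.range_succ]

theorem take_drop_seqPrefix (X : ℕ → A) (i k r : ℕ) :
    ((seqPrefix X (i + k + r)).drop i).take k = seqFactor X i k := by
  have h : i + k + r = i + (k + r) := by omega
  rw [h, seqPrefix_add, List.drop_left' (by simp [seqPrefix]), seqFactor_add,
    List.take_left' (by simp)]

theorem seqFactor_eq_ofFn (X : ℕ → A) (i k : ℕ) :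
    seqFactor X i k = List.ofFn (fun j : Fin k => X (i + j)) := by
  apply List.ext_getElem <;> simp [seqFactor]

variable [DecidableEq A]

/-- The number of positions `i < n` at which `w` occurs in `X`. -/
def occCount (w : List A) (X : ℕ → A) (n : ℕ) : ℕ :=
  ((Finset.range n).filter (fun i => seqFactor X i w.length = w)).card

theorem nbOcc_seqPrefix (w : List A) (X : ℕ → A) (n : ℕ) :
    nbOcc w (seqPrefix X (n + w.length)) = occCount w X (n + 1) := by
  unfold nbOcc occCount
  have hl : (seqPrefix X (n + w.length)).length = n + w.length := by simp [seqPrefix]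
  rw [hl, Nat.add_sub_cancel]
  congr 1
  refine Finset.filter_congr fun i hi => ?_
  obtain ⟨r, rfl⟩ := Nat.exists_eq_add_of_le (Nat.lt_succ_iff.1 (Finset.mem_range.1 hi))
  rw [show i + r + w.length = i + w.length + r by omega, take_drop_seqPrefix]

/-- Shifting n by |w| - 1 makes the two quotients literally equal. -/
theorem tendsto_wordFreq_iff (w : List A) (X : ℕ → A) (c : ℝ) :
    Tendsto (fun n => wordFreq w (seqPrefix X n)) atTop (𝓝 c) ↔
      Tendsto (fun n => (occCount w X n : ℝ) / n) atTop (𝓝 c) := by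
  rw [← tendsto_add_atTop_iff_nat w.length, ← tendsto_add_atTop_iff_nat 1]
  conv_rhs => rw [← tendsto_add_atTop_iff_nat 1]
  conv_lhs => rw [tendsto_add_atTop_iff_nat (f := fun n => wordFreq w (seqPrefix X (n + w.length))) 1]
  refine tendsto_congr fun n => ?_
  simp only [wordFreq, nbOcc_seqPrefix]
  simp [seqPrefix]

theorem isNormalSeq_iff (μ : A → ℝ) (X : ℕ → A) :
    IsNormalSeq μ X ↔
      ∀ w : List A, Tendsto (fun n => (occCount w X n : ℝ) / n) atTop (𝓝 (wordProb μ w)) :=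
  forall_congr' fun w => tendsto_wordFreq_iff w X _

theorem occCount_nil (X : ℕ → A) (n : ℕ) : occCount [] X n = n := by
  simp [occCount, seqFactor]

theorem occCount_succ (w : List A) (X : ℕ → A) (n : ℕ) :
    occCount w X (n + 1) = occCount w X n + if seqFactor X n w.length = w then 1 else 0 := by
  unfold occCount
  rw [Finset.range_add_one, Finset.filter_insert]
  split_ifs <;> simp

/-- The sequence is normal as soon as, after each word, each letter has the correct conditional
frequency. -/
theorem isNormalSeq_of_tendsto_append (μ : A → ℝ) (X : ℕ → A)
    (h : ∀ (v : List A) (a : A), Tendsto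
      (fun n : ℕ => ((occCount (v ++ [a]) X n : ℝ) - μ a * occCount v X n) / n) atTop (𝓝 0)) :
    IsNormalSeq μ X := by
  rw [isNormalSeq_iff]
  intro w
  induction w using List.reverseRecOn with
  | nil =>
    refine (tendsto_congr' ?_).2 tendsto_const_nhds
    filter_upwards [eventually_gt_atTop 0] with n hn
    have : (n : ℝ) ≠ 0 := by positivity
    simp [occCount_nil, wordProb, this]
  | append_singleton v a ih =>
    have := (h v a).add (ih.const_mul (μ a))
    simp only [wordProb, List.map_append, List.prod_append, List.map_cons, List.map_nil,
      List.prod_singleton, zero_add] at this ⊢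
    rw [mul_comm]
    refine this.congr fun n => ?_
    ring

end Factors

/-! ### Averages along a normal sequence and decay of submultiplicative functions -/

section Averages

variable {A : Type u} [Fintype A] [DecidableEq A]

theorem sum_seqFactor (X : ℕ → A) (k : ℕ) (f : List A → ℝ) (n : ℕ) :
    ∑ m ∈ Finset.range n, f (seqFactor X m k) =
      ∑ w : Fin k → A, (occCount (List.ofFn w) X n : ℝ) * f (List.ofFn w) := by
  induction n with
  | zero => simp [occCount]
  | succ n ih =>
    rw [Finset.sum_range_succ, ih]
    simp only [occCount_succ, List.length_ofFn, seqFactor_eq_ofFn, List.ofFn_injective.eq_iff,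
      Nat.cast_add, add_mul, Finset.sum_add_distrib]
    simp

/-- Along a normal sequence, averages of a function of the next `k` letters converge to its mean. -/
theorem IsNormalSeq.tendsto_average {μ : A → ℝ} {X : ℕ → A} (hX : IsNormalSeq μ X) (k : ℕ)
    (f : List A → ℝ) :
    Tendsto (fun n : ℕ => (∑ m ∈ Finset.range n, f (seqFactor X m k)) / n) atTop
      (𝓝 (∑ w : Fin k → A, wordProb μ (List.ofFn w) * f (List.ofFn w))) := by
  rw [isNormalSeq_iff] at hX
  simp only [sum_seqFactor, Finset.sum_div]
  refine tendsto_finsetSum _ fun w _ => ?_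
  refine ((hX (List.ofFn w)).mul_const (f (List.ofFn w))).congr fun n => ?_
  ring

omit [DecidableEq A] in
-- Noncommutative expansion of a power. With matrices for `M`, averaging products over random words
-- gives a power of the mean matrix.
theorem sum_wordProb_smul_prod {R : Type*} [Semiring R] [Algebra ℝ≥0 R] (m : A → ℝ≥0)
    (M : A → R) (k : ℕ) :
    ∑ w : Fin k → A, ((List.ofFn w).map m).prod • ((List.ofFn w).map M).prod =
      (∑ a, m a • M a) ^ k := by
  induction k with
  | zero => simp
  | succ k ih =>
    rw [← (Fin.consEquiv fun _ => A).sum_comp, Fintype.sum_prod_type, pow_succ', ← ih,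
      Finset.sum_mul_sum]
    refine Finset.sum_congr rfl fun a _ => Finset.sum_congr rfl fun w _ => ?_
    rw [smul_mul_smul_comm]
    simp [Fin.consEquiv, List.ofFn_succ, Function.comp_def]

/-- AM-GM. Normality controls averages only; this transfers the control to products. -/
theorem prod_le_average_pow (f : ℕ → ℝ) (hf : ∀ i, 0 ≤ f i) (n : ℕ) :
    ∏ i ∈ Finset.range n, f i ≤ ((∑ i ∈ Finset.range n, f i) / n) ^ n := by
  rcases n.eq_zero_or_pos with rfl | hn
  · simp
  have hn' : (n : ℝ) ≠ 0 := by positivity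
  have h := Real.geom_mean_le_arith_mean (Finset.range n) (fun _ => 1) f (by simp)
    (by simpa using hn) (fun i _ => hf i)
  simp only [Real.rpow_one, Finset.sum_const, Finset.card_range, nsmul_eq_mul, mul_one,
    one_mul] at h
  have hp : 0 ≤ ∏ i ∈ Finset.range n, f i := Finset.prod_nonneg fun i _ => hf i
  calc ∏ i ∈ Finset.range n, f i
      = ((∏ i ∈ Finset.range n, f i) ^ ((n : ℝ)⁻¹)) ^ n := by
        rw [Real.rpow_inv_natCast_pow hp hn.ne']
    _ ≤ _ := pow_le_pow_left₀ (Real.rpow_nonneg hp _) h n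

/-- A submultiplicative function of words whose mean over the words of some length is less than
`1` decreases exponentially along the prefixes of a normal sequence. -/
theorem IsNormalSeq.exists_le_mul_pow {μ : A → ℝ} {X : ℕ → A} (hX : IsNormalSeq μ X)
    (H : List A → ℝ) (hH : ∀ w, 0 ≤ H w) (hmul : ∀ u w, H (u ++ w) ≤ H u * H w) {k : ℕ}
    (hk0 : k ≠ 0) (hk : ∑ w : Fin k → A, wordProb μ (List.ofFn w) * H (List.ofFn w) < 1) :
    ∃ C r : ℝ, 0 < r ∧ r < 1 ∧ ∀ᶠ n in atTop, H (seqPrefix X n) ≤ C * r ^ n := by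
  obtain ⟨s, hs, hs1⟩ := exists_between (max_lt hk one_pos)
  have hs0 : 0 < s := (le_max_right _ _).trans_lt hs
  obtain ⟨B, hB⟩ : ∃ B : ℝ, ∀ a, H [a] ≤ B :=
    ⟨∑ a, H [a], fun a => Finset.single_le_sum (f := fun a => H [a]) (fun a _ => hH _)
      (Finset.mem_univ a)⟩
  have hB1 : (1 : ℝ) ≤ max B 1 := le_max_right _ _
  set B' := max B 1
  set a : ℕ → ℝ := fun n => H (seqPrefix X n) with ha
  have ha0 : ∀ n, 0 ≤ a n := fun n => hH _
  have hstep : ∀ n j, a (n + j) ≤ B' ^ j * a n := by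
    intro n j
    induction j with
    | zero => simp
    | succ j ih =>
      calc a (n + (j + 1)) ≤ a (n + j) * H [X (n + j)] := by
            simp only [ha, ← add_assoc, seqPrefix_succ]; exact hmul _ _
        _ ≤ (B' ^ j * a n) * B' := mul_le_mul ih ((hB _).trans (le_max_left _ _)) (hH _)
            (mul_nonneg (by positivity) (ha0 _))
        _ = B' ^ (j + 1) * a n := by ring
  -- Multiplying k consecutive values treats all cuttings of X into blocks of length k at once, so
  -- overlapping factors suffice. Moving the window one step replaces `a n` by `a (n + k)`, at the
  -- cost of one factor `H (seqFactor X n k)`.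
  set p : ℕ → ℝ := fun n => ∏ j ∈ Finset.range k, a (n + j) with hp
  have hp0 : ∀ n, 0 ≤ p n := fun n => Finset.prod_nonneg fun j _ => ha0 _
  have hprod : ∀ n, p n ≤ p 0 * ∏ m ∈ Finset.range n, H (seqFactor X m k) := by
    intro n
    induction n with
    | zero => simp
    | succ n ih =>
      obtain ⟨l, rfl⟩ := Nat.exists_eq_succ_of_ne_zero hk0
      have h1 : p (n + 1) = (∏ j ∈ Finset.range l, a (n + (j + 1))) * a (n + (l + 1)) := by
        simp only [hp, Finset.prod_range_succ]
        simp [add_assoc, add_comm 1]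
      have h2 : p n = (∏ j ∈ Finset.range l, a (n + (j + 1))) * a n := by
        simp [hp, Finset.prod_range_succ']
      have h3 : a (n + (l + 1)) ≤ a n * H (seqFactor X n (l + 1)) := by
        simp only [ha, seqPrefix_add X n]; exact hmul _ _
      calc p (n + 1) ≤ (∏ j ∈ Finset.range l, a (n + (j + 1))) *
              (a n * H (seqFactor X n (l + 1))) := by
            rw [h1]
            exact mul_le_mul_of_nonneg_left h3 (Finset.prod_nonneg fun j _ => ha0 _)
        _ = p n * H (seqFactor X n (l + 1)) := by rw [h2]; ring
        _ ≤ _ := by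
            rw [Finset.prod_range_succ, ← mul_assoc]
            exact mul_le_mul_of_nonneg_right ih (hH _)
  -- Each value in the window bounds `a (n + k)` up to a factor `B' ^ k`.
  have hpow : ∀ n, a (n + k) ^ k ≤ B' ^ (k * k) * p n := by
    intro n
    calc a (n + k) ^ k = ∏ j ∈ Finset.range k, a (n + k) := by simp
      _ ≤ ∏ j ∈ Finset.range k, (B' ^ k * a (n + j)) := by
          refine Finset.prod_le_prod (fun _ _ => ha0 _) fun j hj => ?_
          have hj' : j ≤ k := (Finset.mem_range.1 hj).le
          calc a (n + k) = a (n + j + (k - j)) := by congr 1; omega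
            _ ≤ B' ^ (k - j) * a (n + j) := hstep _ _
            _ ≤ B' ^ k * a (n + j) := mul_le_mul_of_nonneg_right
                (pow_le_pow_right₀ hB1 (Nat.sub_le _ _)) (ha0 _)
      _ = B' ^ (k * k) * p n := by simp [Finset.prod_mul_distrib, hp, pow_mul]
  have hD0 : 0 ≤ B' ^ (k * k) * p 0 := mul_nonneg (by positivity) (hp0 0)
  set D := (B' ^ (k * k) * p 0) ^ ((k : ℝ)⁻¹) with hD
  set t := s ^ ((k : ℝ)⁻¹) with ht
  have hDk : D ^ k = B' ^ (k * k) * p 0 := Real.rpow_inv_natCast_pow hD0 hk0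
  have htk : t ^ k = s := Real.rpow_inv_natCast_pow hs0.le hk0
  have ht0 : 0 < t := Real.rpow_pos_of_pos hs0 _
  have ht1 : t < 1 := Real.rpow_lt_one hs0.le hs1 (by positivity)
  have hDnn : 0 ≤ D := Real.rpow_nonneg hD0 _
  refine ⟨D / t ^ k, t, ht0, ht1, ?_⟩
  have hev : ∀ᶠ n in atTop, a (n + k) ≤ D / t ^ k * t ^ (n + k) := by
    filter_upwards [(hX.tendsto_average k H).eventually_lt_const ((le_max_left _ _).trans_lt hs)]
      with n hn
    have hle : ∏ m ∈ Finset.range n, H (seqFactor X m k) ≤ s ^ n :=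
      (prod_le_average_pow _ (fun _ => hH _) n).trans (pow_le_pow_left₀
        (div_nonneg (Finset.sum_nonneg fun _ _ => hH _) (Nat.cast_nonneg n)) hn.le n)
    have hmain : a (n + k) ^ k ≤ (D * t ^ n) ^ k := by
      calc a (n + k) ^ k ≤ B' ^ (k * k) * p n := hpow n
        _ ≤ B' ^ (k * k) * (p 0 * s ^ n) := mul_le_mul_of_nonneg_left
            ((hprod n).trans (mul_le_mul_of_nonneg_left hle (hp0 0))) (by positivity)
        _ = (D * t ^ n) ^ k := by
            rw [mul_pow, hDk, ← pow_mul t, mul_comm n k, pow_mul t, htk]; ring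
    refine (le_of_pow_le_pow_left₀ hk0 (by positivity) hmain).trans_eq ?_
    rw [pow_add]
    field_simp
  obtain ⟨N, hN⟩ := eventually_atTop.1 hev
  filter_upwards [eventually_ge_atTop (N + k)] with n hn
  have := hN (n - k) (by omega)
  rwa [Nat.sub_add_cancel (by omega)] at this

end Averages

/-! ### Substochastic matrices -/

section Substochastic

open Matrix

variable {Q : Type*} [Fintype Q]

theorem nnreal_mulVec_mono (M : Matrix Q Q ℝ≥0) {x y : Q → ℝ≥0} (h : x ≤ y) :
    M *ᵥ x ≤ M *ᵥ y :=
  fun _ => Finset.sum_le_sum fun j _ => mul_le_mul_right (h j) _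

variable [DecidableEq Q]

theorem antitone_pow_mulVec_one {P : Matrix Q Q ℝ≥0} (h1 : P *ᵥ 1 ≤ 1) :
    Antitone fun k : ℕ => P ^ k *ᵥ (1 : Q → ℝ≥0) := by
  refine antitone_nat_of_succ_le fun k => ?_
  rw [pow_succ, ← mulVec_mulVec]
  exact nnreal_mulVec_mono _ h1

theorem pow_mulVec_mono {P R : Matrix Q Q ℝ≥0} (h : ∀ i j, P i j ≤ R i j) (k : ℕ)
    (x : Q → ℝ≥0) : P ^ k *ᵥ x ≤ R ^ k *ᵥ x := by
  induction k with
  | zero => simp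
  | succ k ih =>
    rw [pow_succ', pow_succ', ← mulVec_mulVec, ← mulVec_mulVec]
    refine (nnreal_mulVec_mono P ih).trans fun i => Finset.sum_le_sum fun j _ => ?_
    exact mul_le_mul_left (h i j) _

/-- The powers of a substochastic matrix tend to `0` if from every state mass is lost at some
time. -/
theorem tendsto_pow_mulVec_one_zero {P : Matrix Q Q ℝ≥0} (h1 : P *ᵥ 1 ≤ 1)
    (h : ∀ q, ∃ k : ℕ, (P ^ k *ᵥ (1 : Q → ℝ≥0)) q < 1) (q : Q) :
    Tendsto (fun k : ℕ => (P ^ k *ᵥ (1 : Q → ℝ≥0)) q) atTop (𝓝 0) := by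
  set x : ℕ → Q → ℝ≥0 := fun k => P ^ k *ᵥ 1 with hx
  have hlim : ∀ q, Tendsto (fun k => x k q) atTop (𝓝 (⨅ k, x k q)) := fun q =>
    tendsto_atTop_ciInf (fun i j hij => antitone_pow_mulVec_one h1 hij q) (OrderBot.bddBelow _)
  set l : Q → ℝ≥0 := fun q => ⨅ k, x k q with hl
  -- The limiting mass vector is fixed by `P`. At a state where it is maximal, the loss of mass
  -- within k steps then forces the maximum to be 0.
  have hfix : P *ᵥ l = l := by
    ext1 q
    refine tendsto_nhds_unique ?_ ((tendsto_add_atTop_iff_nat 1).2 (hlim q))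
    have : ∀ k, x (k + 1) q = ∑ j, P q j * x k j := fun k => by
      simp only [hx, pow_succ', ← mulVec_mulVec]; rfl
    simp only [this]
    exact tendsto_finsetSum _ fun j _ => (hlim j).const_mul _
  have hfixk : ∀ k : ℕ, P ^ k *ᵥ l = l := by
    intro k
    induction k with
    | zero => simp
    | succ k ih => rw [pow_succ, ← mulVec_mulVec, hfix, ih]
  have : Nonempty Q := ⟨q⟩
  obtain ⟨q₀, hq₀⟩ := Finite.exists_max l
  obtain ⟨k, hk⟩ := h q₀
  have hle : l q₀ ≤ l q₀ * x k q₀ := by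
    calc l q₀ = (P ^ k *ᵥ l) q₀ := by rw [hfixk]
      _ ≤ (P ^ k *ᵥ (l q₀ • (1 : Q → ℝ≥0))) q₀ :=
          nnreal_mulVec_mono _ (fun j => by simpa using hq₀ j) q₀
      _ = l q₀ * x k q₀ := by rw [mulVec_smul]; rfl
  have hzero : l q₀ = 0 := by
    by_contra hne
    exact (mul_lt_of_lt_one_right (pos_iff_ne_zero.2 hne) hk).not_ge hle
  have : l q = 0 := le_antisymm ((hq₀ q).trans hzero.le) zero_le
  have hq := hlim q
  rwa [show (⨅ k, x k q) = 0 from this] at hq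

end Substochastic

/-! ### The random run of a gambler -/

namespace ProbGambler

open ProbabilityTheory Matrix

variable {A : Type u} [Fintype A] {μ : A → ℝ} (G : ProbGambler.{u, v} A μ)

instance : Finite G.State := G.finState

noncomputable instance : Fintype G.State := Fintype.ofFinite _

noncomputable instance : DecidableEq G.State := Classical.decEq _

instance : DiscreteMeasurableSpace G.State := ⟨fun _ => trivial⟩

instance : IsProbabilityMeasure G.choiceMeasure := by
  unfold choiceMeasure; infer_instance

theorem map_choiceMeasure_eval (i : ℕ × G.State × A) :
    G.choiceMeasure.map (fun ω => ω i) = (G.trans i.2.1 i.2.2).toMeasure :=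
  Measure.infinitePi_map_eval _ i

/-- Almost surely, only transitions of positive probability are chosen. -/
theorem ae_mem_support :
    ∀ᵐ ω ∂G.choiceMeasure, ∀ i : ℕ × G.State × A, ω i ∈ (G.trans i.2.1 i.2.2).support := by
  have : Countable A := Finite.to_countable
  rw [ae_all_iff]
  intro i
  have h : ∀ᵐ q ∂(G.choiceMeasure.map fun ω => ω i), q ∈ (G.trans i.2.1 i.2.2).support := by
    rw [map_choiceMeasure_eval, ← PMF.restrict_toMeasure_support]
    exact ae_restrict_mem (DiscreteMeasurableSpace.forall_measurableSet _)
  exact ae_of_ae_map (measurable_pi_apply i).aemeasurable h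

/-- The information contained in the random choices made before time `n`. -/
@[reducible] def past (n : ℕ) : MeasurableSpace G.Choices :=
  ⨆ i ∈ {i : ℕ × G.State × A | i.1 < n}, MeasurableSpace.comap (fun ω : G.Choices => ω i) ⊤

theorem past_le (n : ℕ) : G.past n ≤ MeasurableSpace.pi :=
  iSup₂_le fun i _ => (measurable_pi_apply i).comap_le

theorem past_mono {m n : ℕ} (h : m ≤ n) : G.past m ≤ G.past n :=
  biSup_mono fun _ hi => lt_of_lt_of_le hi h

theorem measurable_choice_past (i : ℕ × G.State × A) {n : ℕ} (hi : i.1 < n) :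
    Measurable[G.past n] fun ω : G.Choices => ω i :=
  Measurable.of_comap_le (le_iSup₂_of_le i hi le_rfl)

theorem measurable_stateAt (X : ℕ → A) (n : ℕ) :
    Measurable[G.past n] fun ω => G.stateAt X ω n := by
  induction n with
  | zero => exact @measurable_const _ _ _ (G.past 0) _
  | succ n ih =>
    intro s _
    have : (fun ω => G.stateAt X ω (n + 1)) ⁻¹' s =
        ⋃ r, ((fun ω => G.stateAt X ω n) ⁻¹' {r} ∩ (fun ω : G.Choices => ω (n, r, X n)) ⁻¹' s) := by
      ext ω
      simp [stateAt]
    rw [this]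
    refine MeasurableSet.iUnion fun r => MeasurableSet.inter ?_ ?_
    · exact G.past_mono n.le_succ _ (ih (DiscreteMeasurableSpace.forall_measurableSet _))
    · exact G.measurable_choice_past (n, r, X n) n.lt_succ_self
        (DiscreteMeasurableSpace.forall_measurableSet _)

/-- The choices made at time `n` are independent of those made before. -/
theorem indep_past (i : ℕ × G.State × A) :
    Indep (G.past i.1) (MeasurableSpace.comap (fun ω : G.Choices => ω i) ⊤) G.choiceMeasure := by
  have h : iIndepFun (fun (i : ℕ × G.State × A) (ω : G.Choices) => ω i) G.choiceMeasure :=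
    iIndepFun_infinitePi (X := fun _ => id) fun _ => measurable_id
  have := indep_iSup_of_disjoint (fun i => (measurable_pi_apply i).comap_le) h.iIndep
    (S := {j | j.1 < i.1}) (T := {i}) (by simp)
  rw [iSup_singleton] at this
  exact this

/-- The matrix with entries `κ(q, a) · δ(q, a)(q')`. -/
noncomputable def weightedTrans (κ : G.State → A → ℝ≥0) (a : A) : Matrix G.State G.State ℝ≥0 :=
  Matrix.of fun q q' => κ q a * (G.trans q a q').toNNReal

theorem weightedTrans_mulVec (κ : G.State → A → ℝ≥0) (a : A) (φ : G.State → ℝ≥0) (q : G.State) :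
    (G.weightedTrans κ a *ᵥ φ) q = κ q a * ∑ q', (G.trans q a q').toNNReal * φ q' := by
  simp [weightedTrans, mulVec, dotProduct, Finset.mul_sum, mul_assoc]

theorem sum_trans (q : G.State) (a : A) : ∑ q', (G.trans q a q').toNNReal = 1 := by
  have := (G.trans q a).tsum_coe
  rw [tsum_fintype] at this
  rw [← ENNReal.toNNReal_sum fun q' _ => (G.trans q a).apply_ne_top q', this]
  rfl

theorem lintegral_choice (i : ℕ × G.State × A) (φ : G.State → ℝ≥0) :
    ∫⁻ ω, (φ (ω i) : ℝ≥0∞) ∂G.choiceMeasure =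
      ((∑ q', (G.trans i.2.1 i.2.2 q').toNNReal * φ q' : ℝ≥0) : ℝ≥0∞) := by
  rw [← lintegral_map (μ := G.choiceMeasure) (f := fun q => (φ q : ℝ≥0∞)) (g := fun ω => ω i)
    (measurable_of_finite _) (measurable_pi_apply i), map_choiceMeasure_eval, lintegral_fintype]
  push_cast
  refine Finset.sum_congr rfl fun q _ => ?_
  rw [PMF.toMeasure_apply_singleton _ _ (DiscreteMeasurableSpace.forall_measurableSet _), mul_comm,
    ENNReal.coe_toNNReal (PMF.apply_ne_top _ _)]

/-- The product of the weights of the first `n` steps of the run. -/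
noncomputable def runWeight (κ : G.State → A → ℝ≥0) (X : ℕ → A) (n : ℕ) (ω : G.Choices) : ℝ≥0 :=
  ∏ i ∈ Finset.range n, κ (G.stateAt X ω i) (X i)

theorem measurable_runWeight (κ : G.State → A → ℝ≥0) (X : ℕ → A) (n : ℕ) :
    Measurable[G.past n] (G.runWeight κ X n) := by
  unfold runWeight
  refine @Finset.measurable_prod _ _ _ _ _ _ (G.past n) _ _ fun i hi => ?_
  exact (measurable_of_finite fun q => κ q (X i)).comp
    ((G.measurable_stateAt X i).mono (G.past_mono (Finset.mem_range.1 hi).le) le_rfl)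

/-- The last step is integrated out: given the state at time n, the fresh choice is independent of
the past and replaces `φ` by a matrix applied to `φ`. Hence the induction over all `φ`. -/
theorem lintegral_runWeight_mul (κ : G.State → A → ℝ≥0) (X : ℕ → A) (n : ℕ)
    (φ : G.State → ℝ≥0) :
    ∫⁻ ω, (G.runWeight κ X n ω * φ (G.stateAt X ω n) : ℝ≥0) ∂G.choiceMeasure =
      (((((seqPrefix X n).map (G.weightedTrans κ)).prod *ᵥ φ) G.init : ℝ≥0) : ℝ≥0∞) := by
  induction n generalizing φ with
  | zero => simp [runWeight, stateAt, seqPrefix]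
  | succ n ih =>
    -- Splitting by the value q of the current state turns the random index of the choice into a
    -- fixed one, as independence requires.
    set F : G.State → G.Choices → ℝ≥0 := fun q ω =>
      G.runWeight κ X n ω * ({q} : Set G.State).indicator 1 (G.stateAt X ω n) * κ q (X n) with hF
    have hFm : ∀ q, Measurable[G.past n] (F q) := fun q =>
      ((G.measurable_runWeight κ X n).mul
        ((measurable_of_finite (({q} : Set G.State).indicator (1 : G.State → ℝ≥0))).comp
          (G.measurable_stateAt X n))).mul_const (κ q (X n))
    have hsplit : ∀ (ψ : G.State → ℝ≥0) (ω : G.Choices),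
        G.runWeight κ X n ω * (κ (G.stateAt X ω n) (X n) * ψ (G.stateAt X ω n)) =
          ∑ q, F q ω * ψ q := by
      intro ψ ω
      rw [Finset.sum_eq_single (G.stateAt X ω n)]
      · simp [hF, mul_assoc]
      · intro q _ hq
        simp [hF, hq.symm]
      · simp
    have hmeas : ∀ q, Measurable fun ω => (F q ω : ℝ≥0∞) := fun q =>
      ((hFm q).mono (G.past_le n) le_rfl).coe_nnreal_ennreal
    rw [seqPrefix_succ, List.map_append, List.prod_append, ← mulVec_mulVec, List.map_singleton,
      List.prod_singleton, ← ih]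
    simp only [weightedTrans_mulVec]
    have hl : ∀ ω : G.Choices, G.runWeight κ X (n + 1) ω * φ (G.stateAt X ω (n + 1)) =
        ∑ q, F q ω * φ (ω (n, q, X n)) := by
      intro ω
      rw [← hsplit (fun q => φ (ω (n, q, X n))), runWeight, Finset.prod_range_succ, mul_assoc]
      rfl
    simp only [hl, hsplit (fun q => ∑ q', (G.trans q (X n) q').toNNReal * φ q')]
    push_cast
    have hφ : Measurable fun q => (φ q : ℝ≥0∞) := measurable_of_finite _
    have hφn : ∀ q, Measurable fun ω : G.Choices => (φ (ω (n, q, X n)) : ℝ≥0∞) := fun q =>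
      hφ.comp (measurable_pi_apply (n, q, X n))
    have hmul : ∀ q, Measurable fun ω => (F q ω : ℝ≥0∞) * φ (ω (n, q, X n)) := fun q =>
      (hmeas q).mul (hφn q)
    rw [lintegral_finsetSum _ fun q _ => hmul q, lintegral_finsetSum _ fun q _ => (hmeas q).mul_const _]
    refine Finset.sum_congr rfl fun q _ => ?_
    rw [lintegral_mul_const _ (hmeas q)]
    refine (lintegral_mul_eq_lintegral_mul_lintegral_of_independent_measurableSpace (G.past_le n)
      (measurable_pi_apply (n, q, X n)).comap_le (G.indep_past (n, q, X n))
      (hFm q).coe_nnreal_ennreal (hφ.comp (comap_measurable _))).trans ?_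
    simp only [Function.comp_apply, lintegral_choice]
    push_cast
    rfl

end ProbGambler

/-! ### Gamblers on normal sequences -/

theorem upperLogRate_le_log {c : ℕ → ℝ≥0} {s : ℝ≥0} (h : ∀ᶠ n in atTop, c n ≤ s ^ n) :
    upperLogRate c ≤ ENNReal.log s := by
  refine limsup_le_of_le (by isBoundedDefault) ?_
  filter_upwards [h, eventually_gt_atTop 0] with n hn hpos
  have hn0 : (0 : EReal) < n := by exact_mod_cast hpos
  rw [EReal.div_le_iff_le_mul hn0 (EReal.natCast_ne_top n), ← ENNReal.log_pow]
  exact ENNReal.log_le_log (by exact_mod_cast hn)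

/-- With t = √r, the terms t⁻ⁿ Dₙ have expectation at most C tⁿ from some index on. The tail sum is
therefore almost surely finite and its terms are eventually below 1. -/
theorem ENNReal.ae_eventually_le_pow {Ω : Type*} [MeasurableSpace Ω] {P : Measure Ω}
    {D : ℕ → Ω → ℝ≥0} (hD : ∀ n, Measurable (D n)) {C r : ℝ≥0} (hr0 : 0 < r) (hr1 : r < 1)
    (h : ∀ᶠ n in atTop, ∫⁻ ω, (D n ω : ℝ≥0∞) ∂P ≤ ((C * r ^ n : ℝ≥0) : ℝ≥0∞)) :
    ∀ᵐ ω ∂P, ∀ᶠ n in atTop, D n ω ≤ NNReal.sqrt r ^ n := by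
  obtain ⟨N, hN⟩ := eventually_atTop.1 h
  set t := NNReal.sqrt r with ht
  have ht0 : 0 < t := NNReal.sqrt_pos.2 hr0
  have ht1 : t < 1 := by simpa [ht] using NNReal.sqrt_lt_sqrt.2 hr1
  have htt : r = t * t := (NNReal.mul_self_sqrt r).symm
  have hmeas : ∀ n, Measurable fun ω => ((t⁻¹ ^ (n + N) * D (n + N) ω : ℝ≥0) : ℝ≥0∞) := fun n =>
    ((hD _).const_mul _).coe_nnreal_ennreal
  have hint : ∫⁻ ω, ∑' n : ℕ, ((t⁻¹ ^ (n + N) * D (n + N) ω : ℝ≥0) : ℝ≥0∞) ∂P ≠ ∞ := by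
    rw [lintegral_tsum fun n => (hmeas n).aemeasurable]
    have hle : ∀ n : ℕ, ∫⁻ ω, ((t⁻¹ ^ (n + N) * D (n + N) ω : ℝ≥0) : ℝ≥0∞) ∂P ≤
        ((C * t ^ N * t ^ n : ℝ≥0) : ℝ≥0∞) := by
      intro n
      simp only [ENNReal.coe_mul (t⁻¹ ^ (n + N))]
      rw [lintegral_const_mul _ (hD _).coe_nnreal_ennreal]
      refine (mul_le_mul_right (hN (n + N) (Nat.le_add_left _ _)) _).trans_eq ?_
      rw [← ENNReal.coe_mul, htt, mul_pow, pow_add t n N, inv_pow]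
      congr 1
      field_simp
      ring
    refine ne_top_of_le_ne_top ?_ (ENNReal.tsum_le_tsum hle)
    rw [ENNReal.tsum_coe_ne_top_iff_summable]
    exact (NNReal.summable_geometric ht1).mul_left _
  filter_upwards [ae_lt_top (Measurable.tsum hmeas) hint] with ω hω
  have hlim := ENNReal.tendsto_cofinite_zero_of_tsum_ne_top hω.ne
  rw [Nat.cofinite_eq_atTop] at hlim
  have hev := (tendsto_order.1 hlim).2 1 one_pos
  obtain ⟨M, hM⟩ := eventually_atTop.1 hev
  filter_upwards [eventually_ge_atTop (M + N)] with n hn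
  have h1 := hM (n - N) (by omega)
  rw [Nat.sub_add_cancel (by omega), ENNReal.coe_lt_one_iff, inv_pow,
    inv_mul_lt_iff₀ (pow_pos ht0 n), mul_one] at h1
  exact h1.le

/-! ### Mean matrices, safe states and almost sure decay -/

namespace ProbGambler

open ProbabilityTheory Matrix

variable {A : Type u} [Fintype A] {μ : A → ℝ} (G : ProbGambler.{u, v} A μ)

/-- The mean of the matrices `weightedTrans κ a` under `μ`. -/
noncomputable def meanTrans (κ : G.State → A → ℝ≥0) : Matrix G.State G.State ℝ≥0 :=
  ∑ a, (μ a).toNNReal • G.weightedTrans κ a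

theorem meanTrans_mulVec (κ : G.State → A → ℝ≥0) (φ : G.State → ℝ≥0) (q : G.State) :
    (G.meanTrans κ *ᵥ φ) q =
      ∑ a, (μ a).toNNReal * (κ q a * ∑ q', (G.trans q a q').toNNReal * φ q') := by
  simp only [← weightedTrans_mulVec, meanTrans, sum_mulVec, Finset.sum_apply, smul_mulVec]
  rfl

theorem meanTrans_mulVec_one (κ : G.State → A → ℝ≥0) (q : G.State) :
    (G.meanTrans κ *ᵥ 1) q = ∑ a, (μ a).toNNReal * κ q a := by
  simp [meanTrans_mulVec, sum_trans]

/-- The square root of the betting function. -/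
noncomputable def sqrtBet (q : G.State) (a : A) : ℝ≥0 :=
  NNReal.sqrt (G.bet q a)

/-- The states from which the gambler never bets again. -/
def safe : Set G.State :=
  {q | ∀ k : ℕ, 1 ≤ ((G.meanTrans G.sqrtBet) ^ k *ᵥ (1 : G.State → ℝ≥0)) q}

open Classical in
/-- The square root of the betting function, set to zero in the safe states. -/
noncomputable def killedBet (q : G.State) (a : A) : ℝ≥0 :=
  if q ∈ G.safe then 0 else G.sqrtBet q a

/-- Expand the square and use fairness. The mass lost in one step is thus half a weighted sum of
squares, which vanishes only if every bet is 1. -/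
theorem sum_sq_sqrtBet_sub_one (hμ : ∀ a, 0 < μ a) (hsum : ∑ a, μ a = 1) (q : G.State) :
    ∑ a, μ a * ((G.sqrtBet q a : ℝ) - 1) ^ 2 =
      2 * (1 - ((∑ a, (μ a).toNNReal * G.sqrtBet q a : ℝ≥0) : ℝ)) := by
  have h : ∀ a, μ a * ((G.sqrtBet q a : ℝ) - 1) ^ 2 =
      μ a * (G.bet q a : ℝ) - 2 * (μ a * G.sqrtBet q a) + μ a := by
    intro a
    have : (G.bet q a : ℝ) = (G.sqrtBet q a : ℝ) ^ 2 := by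
      exact_mod_cast (NNReal.sq_sqrt (G.bet q a)).symm
    rw [this]; ring
  simp only [h, Finset.sum_add_distrib, Finset.sum_sub_distrib, G.fair, hsum, ← Finset.mul_sum]
  push_cast
  simp only [Real.coe_toNNReal _ (hμ _).le]
  ring

theorem meanTrans_sqrtBet_mulVec_one_le (hμ : ∀ a, 0 < μ a) (hsum : ∑ a, μ a = 1) :
    G.meanTrans G.sqrtBet *ᵥ 1 ≤ 1 := by
  intro q
  rw [meanTrans_mulVec_one, Pi.one_apply, ← NNReal.coe_le_coe, NNReal.coe_one]
  have h := G.sum_sq_sqrtBet_sub_one hμ hsum q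
  have h0 : 0 ≤ ∑ a, μ a * ((G.sqrtBet q a : ℝ) - 1) ^ 2 :=
    Finset.sum_nonneg fun a _ => mul_nonneg (hμ a).le (sq_nonneg _)
  linarith

theorem sqrtBet_eq_one_of_mem_safe (hμ : ∀ a, 0 < μ a) (hsum : ∑ a, μ a = 1) {q : G.State}
    (hq : q ∈ G.safe) (a : A) : G.sqrtBet q a = 1 := by
  have h1 := hq 1
  rw [pow_one, meanTrans_mulVec_one, ← NNReal.coe_le_coe, NNReal.coe_one] at h1
  have h := G.sum_sq_sqrtBet_sub_one hμ hsum q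
  have hnn : ∀ a ∈ Finset.univ, 0 ≤ μ a * ((G.sqrtBet q a : ℝ) - 1) ^ 2 :=
    fun a _ => mul_nonneg (hμ a).le (sq_nonneg _)
  have h0 := (Finset.sum_eq_zero_iff_of_nonneg hnn).1
    (le_antisymm (by linarith) (Finset.sum_nonneg hnn)) a (Finset.mem_univ a)
  have h2 : ((G.sqrtBet q a : ℝ) - 1) ^ 2 = 0 := (mul_eq_zero.1 h0).resolve_left (hμ a).ne'
  exact_mod_cast sub_eq_zero.1 (pow_eq_zero_iff two_ne_zero |>.1 h2)

theorem bet_eq_one_of_mem_safe (hμ : ∀ a, 0 < μ a) (hsum : ∑ a, μ a = 1) {q : G.State}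
    (hq : q ∈ G.safe) (a : A) : G.bet q a = 1 := by
  have := G.sqrtBet_eq_one_of_mem_safe hμ hsum hq a
  rwa [sqrtBet, NNReal.sqrt_eq_one] at this

/-- At a safe state all weights are 1, so its mass after k + 1 steps is an average of the masses of
its successors after k steps. One reachable successor below 1 would pull this average below 1. -/
theorem mem_safe_of_mem_support (hμ : ∀ a, 0 < μ a) (hsum : ∑ a, μ a = 1) {q q' : G.State}
    (hq : q ∈ G.safe) {a : A} (h : q' ∈ (G.trans q a).support) : q' ∈ G.safe := by
  intro k
  by_contra! hlt
  set x : G.State → ℝ≥0 := G.meanTrans G.sqrtBet ^ k *ᵥ 1 with hx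
  have hx1 : ∀ r, x r ≤ 1 := fun r => by
    simpa using antitone_pow_mulVec_one (G.meanTrans_sqrtBet_mulVec_one_le hμ hsum)
      (Nat.zero_le k) r
  have hp : ∀ r b r', (G.trans r b r').toNNReal * x r' ≤ (G.trans r b r').toNNReal :=
    fun r b r' => mul_le_of_le_one_right' (hx1 r')
  have hin : ∀ b, ∑ r', (G.trans q b r').toNNReal * x r' ≤ 1 := fun b =>
    (Finset.sum_le_sum fun r' _ => hp q b r').trans_eq (G.sum_trans q b)
  have hstrict : ∑ r', (G.trans q a r').toNNReal * x r' < 1 := by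
    rw [← G.sum_trans q a]
    refine Finset.sum_lt_sum (fun r' _ => hp q a r') ⟨q', Finset.mem_univ _, ?_⟩
    refine mul_lt_of_lt_one_right ?_ hlt
    exact ENNReal.toNNReal_pos ((G.trans q a).mem_support_iff q' |>.1 h)
      ((G.trans q a).apply_ne_top q')
  have hsum' : ∑ b, (μ b).toNNReal = 1 := by
    rw [← NNReal.coe_inj]
    push_cast
    simpa only [Real.coe_toNNReal _ (hμ _).le] using hsum
  have hk := hq (k + 1)
  rw [pow_succ', ← mulVec_mulVec, meanTrans_mulVec] at hk
  simp only [G.sqrtBet_eq_one_of_mem_safe hμ hsum hq, one_mul] at hk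
  refine hk.not_gt ?_
  rw [← hsum']
  refine Finset.sum_lt_sum (fun b _ => mul_le_of_le_one_right' (hin b)) ⟨a, Finset.mem_univ _, ?_⟩
  exact mul_lt_of_lt_one_right (Real.toNNReal_pos.2 (hμ a)) hstrict

theorem killedBet_le (q : G.State) (a : A) : G.killedBet q a ≤ G.sqrtBet q a := by
  unfold killedBet
  split_ifs <;> simp

theorem meanTrans_killedBet_le (q q' : G.State) :
    G.meanTrans G.killedBet q q' ≤ G.meanTrans G.sqrtBet q q' := by
  simp only [meanTrans, Matrix.sum_apply, Matrix.smul_apply, weightedTrans, Matrix.of_apply,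
    smul_eq_mul]
  gcongr
  exact G.killedBet_le _ _

/-- A safe state loses everything in one step; any other state loses mass already without killing.
-/
theorem exists_pow_killed_lt_one (q : G.State) :
    ∃ k : ℕ, (G.meanTrans G.killedBet ^ k *ᵥ (1 : G.State → ℝ≥0)) q < 1 := by
  by_cases hq : q ∈ G.safe
  · refine ⟨1, ?_⟩
    rw [pow_one, meanTrans_mulVec_one]
    simp [killedBet, hq]
  · simp only [safe, Set.mem_ofPred_eq, not_forall, not_le] at hq
    obtain ⟨k, hk⟩ := hq
    exact ⟨k, (pow_mulVec_mono G.meanTrans_killedBet_le k 1 q).trans_lt hk⟩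

theorem meanTrans_killedBet_mulVec_one_le (hμ : ∀ a, 0 < μ a) (hsum : ∑ a, μ a = 1) :
    G.meanTrans G.killedBet *ᵥ 1 ≤ 1 := by
  have := pow_mulVec_mono G.meanTrans_killedBet_le 1 1
  rw [pow_one, pow_one] at this
  exact this.trans (G.meanTrans_sqrtBet_mulVec_one_le hμ hsum)

/-- The total mass of the product of the matrices of the letters of a word. -/
noncomputable def totalWeight (κ : G.State → A → ℝ≥0) (w : List A) : ℝ≥0 :=
  ∑ q, ((w.map (G.weightedTrans κ)).prod *ᵥ 1) q

/-- The row sums of the second product are each at most their total, a constant that factors out. -/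
theorem totalWeight_append_le (κ : G.State → A → ℝ≥0) (u w : List A) :
    G.totalWeight κ (u ++ w) ≤ G.totalWeight κ u * G.totalWeight κ w := by
  have h : (w.map (G.weightedTrans κ)).prod *ᵥ 1 ≤ G.totalWeight κ w • (1 : G.State → ℝ≥0) := by
    intro q
    simp only [Pi.smul_apply, Pi.one_apply, smul_eq_mul, mul_one, totalWeight]
    exact Finset.single_le_sum (f := fun q => ((w.map (G.weightedTrans κ)).prod *ᵥ 1) q)
      (fun _ _ => zero_le) (Finset.mem_univ q)
  rw [totalWeight, List.map_append, List.prod_append, ← mulVec_mulVec, totalWeight,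
    Finset.sum_mul]
  refine Finset.sum_le_sum fun q _ => (nnreal_mulVec_mono _ h q).trans_eq ?_
  rw [mulVec_smul, Pi.smul_apply, smul_eq_mul, mul_comm]

theorem sum_wordProb_mul_totalWeight (hμ : ∀ a, 0 < μ a) (κ : G.State → A → ℝ≥0) (k : ℕ) :
    ∑ w : Fin k → A, wordProb μ (List.ofFn w) * (G.totalWeight κ (List.ofFn w) : ℝ) =
      ((∑ q, (G.meanTrans κ ^ k *ᵥ 1) q : ℝ≥0) : ℝ) := by
  have hw : ∀ w : List A, wordProb μ w = ((w.map fun a => (μ a).toNNReal).prod : ℝ≥0) := by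
    intro w
    simp [wordProb, NNReal.coe_list_prod, Function.comp_def, Real.coe_toNNReal _ (hμ _).le]
  simp only [hw]
  rw [meanTrans, ← sum_wordProb_smul_prod]
  simp only [sum_mulVec, Finset.sum_apply, smul_mulVec, Pi.smul_apply, smul_eq_mul]
  rw [Finset.sum_comm]
  simp [totalWeight, Finset.mul_sum]

theorem exists_lintegral_runWeight_le [DecidableEq A] (hμ : ∀ a, 0 < μ a) (hsum : ∑ a, μ a = 1)
    {X : ℕ → A} (hX : IsNormalSeq μ X) :
    ∃ C r : ℝ≥0, 0 < r ∧ r < 1 ∧ ∀ᶠ n in atTop,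
      ∫⁻ ω, (G.runWeight G.killedBet X n ω : ℝ≥0∞) ∂G.choiceMeasure ≤
        ((C * r ^ n : ℝ≥0) : ℝ≥0∞) := by
  have hlim : Tendsto (fun k : ℕ => ∑ q, (G.meanTrans G.killedBet ^ k *ᵥ 1) q) atTop (𝓝 0) := by
    simpa using tendsto_finsetSum Finset.univ fun q _ => tendsto_pow_mulVec_one_zero
      (G.meanTrans_killedBet_mulVec_one_le hμ hsum) G.exists_pow_killed_lt_one q
  obtain ⟨k, hk, hk0⟩ :=
    (((tendsto_order.1 hlim).2 1 one_pos).and (eventually_ne_atTop 0)).exists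
  obtain ⟨C, r, hr0, hr1, h⟩ := hX.exists_le_mul_pow
    (fun w => (G.totalWeight G.killedBet w : ℝ)) (fun w => NNReal.coe_nonneg _)
    (fun u w => by exact_mod_cast G.totalWeight_append_le _ u w) hk0
    (by rw [G.sum_wordProb_mul_totalWeight hμ]; exact_mod_cast hk)
  lift r to ℝ≥0 using hr0.le
  refine ⟨C.toNNReal, r, by exact_mod_cast hr0, by exact_mod_cast hr1, ?_⟩
  filter_upwards [h] with n hn
  have h1 := G.lintegral_runWeight_mul G.killedBet X n 1
  simp only [Pi.one_apply, mul_one] at h1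
  rw [h1, ENNReal.coe_le_coe]
  refine (Finset.single_le_sum (f := fun q =>
    (((seqPrefix X n).map (G.weightedTrans G.killedBet)).prod *ᵥ 1) q)
      (fun _ _ => zero_le) (Finset.mem_univ G.init)).trans ?_
  have h2 : (G.totalWeight G.killedBet (seqPrefix X n) : ℝ) ≤ (C.toNNReal * r ^ n : ℝ≥0) := by
    push_cast
    exact hn.trans (mul_le_mul_of_nonneg_right (le_max_left _ _) (by positivity))
  exact_mod_cast h2

theorem ultimatelyConstant_of_mem_safe (hμ : ∀ a, 0 < μ a) (hsum : ∑ a, μ a = 1) {X : ℕ → A}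
    {ω : G.Choices} (hω : ∀ i : ℕ × G.State × A, ω i ∈ (G.trans i.2.1 i.2.2).support) {N : ℕ}
    (hN : G.stateAt X ω N ∈ G.safe) : UltimatelyConstant (G.capital X ω) := by
  have hsafe : ∀ n, N ≤ n → G.stateAt X ω n ∈ G.safe := by
    intro n hn
    induction n, hn using Nat.le_induction with
    | base => exact hN
    | succ n _ ih => exact G.mem_safe_of_mem_support hμ hsum ih (hω (n, G.stateAt X ω n, X n))
  refine ⟨G.capital X ω N, eventually_atTop.2 ⟨N, fun n hn => ?_⟩⟩
  induction n, hn using Nat.le_induction with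
  | base => rfl
  | succ n hn ih =>
    rw [capital, ih, G.bet_eq_one_of_mem_safe hμ hsum (hsafe n hn), mul_one]

theorem runWeight_sq_eq_capital {X : ℕ → A} {ω : G.Choices}
    (h : ∀ n, G.stateAt X ω n ∉ G.safe) (n : ℕ) :
    G.runWeight G.killedBet X n ω ^ 2 = G.capital X ω n := by
  induction n with
  | zero => simp [runWeight, capital]
  | succ n ih =>
    rw [runWeight, Finset.prod_range_succ, mul_pow, ← runWeight, ih, capital, killedBet,
      if_neg (h n), sqrtBet, NNReal.sq_sqrt]

/-- On a normal sequence, the capital is almost surely ultimately constant or decreases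
exponentially. -/
theorem ae_ultimatelyConstant_or_decreasesExponentially [DecidableEq A] (hμ : ∀ a, 0 < μ a)
    (hsum : ∑ a, μ a = 1) {X : ℕ → A} (hX : IsNormalSeq μ X) :
    ∀ᵐ ω ∂G.choiceMeasure,
      UltimatelyConstant (G.capital X ω) ∨ DecreasesExponentially (G.capital X ω) := by
  obtain ⟨C, r, hr0, hr1, h⟩ := G.exists_lintegral_runWeight_le hμ hsum hX
  filter_upwards [G.ae_mem_support, ENNReal.ae_eventually_le_pow
    (fun n => (G.measurable_runWeight G.killedBet X n).mono (G.past_le n) le_rfl) hr0 hr1 h]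
    with ω hω hle
  by_cases hs : ∃ N, G.stateAt X ω N ∈ G.safe
  · obtain ⟨N, hN⟩ := hs
    exact Or.inl (G.ultimatelyConstant_of_mem_safe hμ hsum hω hN)
  · push Not at hs
    -- Outside the safe states the capital is the square of the weight, so the bound `NNReal.sqrt r
    -- ^ n` becomes `r ^ n`.
    refine Or.inr ((upperLogRate_le_log (s := r) ?_).trans_lt ?_)
    · filter_upwards [hle] with n hn
      rw [← G.runWeight_sq_eq_capital hs]
      refine (pow_le_pow_left₀ zero_le hn 2).trans_eq ?_
      rw [← pow_mul, mul_comm, pow_mul, NNReal.sq_sqrt]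
    · rw [ENNReal.log_lt_zero_iff]
      exact_mod_cast hr1

end ProbGambler

/-! ### A gambler that wins against a sequence that is not normal -/

theorem growsExponentiallyIO_of_frequently {c : ℕ → ℝ≥0} {s : ℝ} (hs : 0 < s)
    (h : ∃ᶠ n : ℕ in atTop, Real.exp (s * n) ≤ c n) : GrowsExponentiallyIO c := by
  have hs' : (0 : EReal) < (s : EReal) := by exact_mod_cast hs
  refine hs'.trans_le (le_limsup_of_frequently_le ?_ (by isBoundedDefault))
  refine (h.and_eventually (eventually_gt_atTop 0)).mono fun n hn => ?_
  have hn0 : (0 : EReal) < n := by exact_mod_cast hn.2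
  rw [EReal.le_div_iff_mul_le hn0 (EReal.natCast_ne_top n)]
  have h1 : ENNReal.ofReal (Real.exp (s * n)) ≤ (c n : ℝ≥0∞) := by
    rw [← ENNReal.ofReal_coe_nnreal]
    exact ENNReal.ofReal_le_ofReal hn.1
  refine le_trans (le_of_eq ?_) (ENNReal.log_le_log h1)
  rw [ENNReal.log_ofReal_of_pos (Real.exp_pos _), Real.log_exp]
  push_cast
  rfl

/-- From log(1 + x) ≥ 1 - 1/(1 + x); the remaining difference is x²(1 + 2x)/(1 + x). -/
theorem exp_sub_two_mul_sq_le {x : ℝ} (hx : -(1 / 2) ≤ x) : Real.exp (x - 2 * x ^ 2) ≤ 1 + x := by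
  have hpos : 0 < 1 + x := by linarith
  rw [← Real.le_log_iff_exp_le hpos]
  refine le_trans ?_ (Real.one_sub_inv_le_log_of_pos hpos)
  have h : 1 - (1 + x)⁻¹ - (x - 2 * x ^ 2) = x ^ 2 * (1 + 2 * x) / (1 + x) := by
    field_simp
    ring
  have : 0 ≤ x ^ 2 * (1 + 2 * x) / (1 + x) :=
    div_nonneg (mul_nonneg (sq_nonneg x) (by linarith)) hpos.le
  linarith

/-! ### Betting on one letter after a fixed word -/

section WordGambler

variable {A : Type u} [Fintype A] [DecidableEq A] {μ : A → ℝ}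

/-- The factor by which a bet of size `θ` on the letter `a` multiplies the capital when the letter
`b` is read. -/
def letterBet (μ : A → ℝ) (a : A) (θ : ℝ) (b : A) : ℝ :=
  1 + θ * ((if b = a then 1 else 0) - μ a)

theorem abs_indicator_sub_le_one (hμ : ∀ a, 0 < μ a) (hsum : ∑ a, μ a = 1) (a b : A) :
    |(if b = a then (1 : ℝ) else 0) - μ a| ≤ 1 := by
  have h0 := hμ a
  have h1 : μ a ≤ 1 := hsum ▸ Finset.single_le_sum (fun b _ => (hμ b).le) (Finset.mem_univ a)
  rw [abs_le]
  split_ifs <;> constructor <;> linarith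

theorem exp_le_letterBet (hμ : ∀ a, 0 < μ a) (hsum : ∑ a, μ a = 1) {θ : ℝ} (hθ : |θ| ≤ 1 / 2)
    (a b : A) :
    Real.exp (θ * ((if b = a then 1 else 0) - μ a) - 2 * θ ^ 2) ≤ letterBet μ a θ b := by
  set y : ℝ := (if b = a then 1 else 0) - μ a with hy
  have hy1 : |y| ≤ 1 := abs_indicator_sub_le_one hμ hsum a b
  have hx : |θ * y| ≤ 1 / 2 := by
    rw [abs_mul]
    exact (mul_le_of_le_one_right (abs_nonneg _) hy1).trans hθ
  refine le_trans (Real.exp_le_exp.2 ?_) (exp_sub_two_mul_sq_le (abs_le.1 hx).1)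
  have : y ^ 2 ≤ 1 := (sq_le_one_iff_abs_le_one y).2 hy1
  nlinarith [sq_nonneg θ]

theorem sum_mul_letterBet (hsum : ∑ a, μ a = 1) (a : A) (θ : ℝ) :
    ∑ b, μ b * letterBet μ a θ b = 1 := by
  have h : ∀ b, μ b * letterBet μ a θ b =
      μ b + θ * (μ b * (if b = a then 1 else 0)) - θ * μ a * μ b := fun b => by
    unfold letterBet; ring
  simp only [h, Finset.sum_add_distrib, Finset.sum_sub_distrib, ← Finset.mul_sum, hsum]
  simp

open Classical in
/-- The gambler that bets on the letter `a` whenever the word `v` has just been read. Its state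
records which prefixes of `v` have just been read. -/
noncomputable def wordGambler (hμ : ∀ a, 0 < μ a) (hsum : ∑ a, μ a = 1) (v : List A) (a : A)
    (θ : ℝ) (hθ : |θ| ≤ 1 / 2) : ProbGambler.{u, 0} A μ where
  State := Fin (v.length + 1) → Prop
  finState := inferInstance
  init := Fin.cons True fun _ => False
  trans s b := PMF.pure (Fin.cons True fun j => s j.castSucc ∧ v.get j = b)
  bet s b := if s (Fin.last _) then (letterBet μ a θ b).toNNReal else 1
  fair s := by
    have h0 : ∀ b, 0 ≤ letterBet μ a θ b := fun b =>
      (Real.exp_pos _).le.trans (exp_le_letterBet hμ hsum hθ a b)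
    split_ifs
    · simp only [Real.coe_toNNReal _ (h0 _), sum_mul_letterBet hsum]
    · simpa using hsum

variable (hμ : ∀ a, 0 < μ a) (hsum : ∑ a, μ a = 1) (v : List A) (a : A)
    (θ : ℝ) (hθ : |θ| ≤ 1 / 2)

/-- All transitions are Dirac, so the support condition determines the run. The clause `i ≤ n`
guards the truncated subtraction. -/
theorem wordGambler_stateAt {X : ℕ → A} {ω : (wordGambler hμ hsum v a θ hθ).Choices}
    (hω : ∀ i, ω i ∈ ((wordGambler hμ hsum v a θ hθ).trans i.2.1 i.2.2).support) (n : ℕ) :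
    (wordGambler hμ hsum v a θ hθ).stateAt X ω n = fun i : Fin (v.length + 1) =>
      (i : ℕ) ≤ n ∧ seqFactor X (n - i) i = v.take i := by
  induction n with
  | zero =>
    refine funext fun i => propext ?_
    refine Fin.cases ?_ (fun j => ?_) i
    · simp [ProbGambler.stateAt, wordGambler, seqFactor]
    · simp [ProbGambler.stateAt, wordGambler]
  | succ n ih =>
    have h := hω (n, (wordGambler hμ hsum v a θ hθ).stateAt X ω n, X n)
    rw [ih] at h
    have h' := (PMF.mem_support_pure_iff _ _).1 h
    rw [ProbGambler.stateAt, ih]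
    refine h'.trans ?_
    refine funext fun i => propext ?_
    refine Fin.cases ?_ (fun j => ?_) i
    · simp [seqFactor]
    · simp only [Fin.cons_succ, Fin.val_castSucc, Fin.val_succ, Nat.add_sub_add_right,
        Nat.add_le_add_iff_right, List.take_succ_eq_append_getElem j.2, seqFactor_succ]
      constructor
      · rintro ⟨⟨h1, h2⟩, h3⟩
        refine ⟨h1, ?_⟩
        rw [h2, Nat.sub_add_cancel h1, ← h3]
        rfl
      · rintro ⟨h1, h2⟩
        rw [Nat.sub_add_cancel h1] at h2
        have := List.append_inj h2 (by simp [j.2.le])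
        exact ⟨⟨h1, this.1⟩, by simpa using this.2.symm⟩

/-- An occurrence of v at position i is exploited when letter i + |v| is read, hence the shift of
time. The quadratic loss is charged at every position, which only weakens the bound. -/
theorem exp_le_wordGambler_capital {X : ℕ → A} {ω : (wordGambler hμ hsum v a θ hθ).Choices}
    (hω : ∀ i, ω i ∈ ((wordGambler hμ hsum v a θ hθ).trans i.2.1 i.2.2).support) (n : ℕ) :
    Real.exp (θ * ((occCount (v ++ [a]) X n : ℝ) - μ a * occCount v X n) - 2 * θ ^ 2 * n) ≤
      (wordGambler hμ hsum v a θ hθ).capital X ω (n + v.length) := by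
  have hbet : ∀ t, (wordGambler hμ hsum v a θ hθ).bet
      ((wordGambler hμ hsum v a θ hθ).stateAt X ω t) (X t) =
      if v.length ≤ t ∧ seqFactor X (t - v.length) v.length = v then
        (letterBet μ a θ (X t)).toNNReal else 1 := by
    intro t
    rw [wordGambler_stateAt hμ hsum v a θ hθ hω]
    simp [wordGambler]
  induction n with
  | zero =>
    have h1 : ∀ t, t ≤ v.length → (wordGambler hμ hsum v a θ hθ).capital X ω t = 1 := by
      intro t ht
      induction t with
      | zero => rfl
      | succ t ih =>
        rw [ProbGambler.capital, ih (by omega), hbet, if_neg (by omega), mul_one]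
    simp [h1, occCount]
  | succ n ih =>
    rw [Nat.add_right_comm, ProbGambler.capital, hbet, occCount_succ,
      occCount_succ, List.length_append, List.length_singleton, seqFactor_succ]
    simp only [Nat.le_add_left, true_and, Nat.add_sub_cancel]
    by_cases hv : seqFactor X n v.length = v
    · have hv' : (seqFactor X n v.length ++ [X (n + v.length)] = v ++ [a]) ↔
          X (n + v.length) = a := by rw [hv]; simp
      have hstep := exp_le_letterBet hμ hsum hθ a (X (n + v.length))
      rw [if_pos hv, if_pos hv, NNReal.coe_mul,
        Real.coe_toNNReal _ ((Real.exp_pos _).le.trans hstep)]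
      refine le_trans (le_of_eq ?_) (mul_le_mul ih hstep (Real.exp_pos _).le (NNReal.coe_nonneg _))
      rw [← Real.exp_add]
      simp only [hv']
      congr 1
      push_cast
      ring
    · have hv' : ¬ (seqFactor X n v.length ++ [X (n + v.length)] = v ++ [a]) := fun h =>
        hv (List.append_inj h (by simp)).1
      rw [if_neg hv, if_neg hv, if_neg hv', mul_one]
      refine le_trans (Real.exp_le_exp.2 ?_) ih
      push_cast
      nlinarith [sq_nonneg θ]

end WordGambler

/-- Against a sequence that is not normal, some gambler almost surely wins at an infinitely often
exponential rate. -/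
theorem exists_gambler_ae_growsExponentiallyIO {A : Type u} [Fintype A] [DecidableEq A]
    {μ : A → ℝ} (hμ : ∀ a, 0 < μ a) (hsum : ∑ a, μ a = 1) {X : ℕ → A} (hX : ¬ IsNormalSeq μ X) :
    ∃ G : ProbGambler.{u, 0} A μ, ∀ᵐ ω ∂G.choiceMeasure, GrowsExponentiallyIO (G.capital X ω) := by
  obtain ⟨v, a, hva⟩ : ∃ v a, ¬ Tendsto
      (fun n : ℕ => ((occCount (v ++ [a]) X n : ℝ) - μ a * occCount v X n) / n) atTop (𝓝 0) := by
    by_contra! h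
    exact hX (isNormalSeq_of_tendsto_append μ X h)
  set d : ℕ → ℝ := fun n => (occCount (v ++ [a]) X n : ℝ) - μ a * occCount v X n with hd
  obtain ⟨ε, hε0, hε1, hε⟩ : ∃ ε : ℝ, 0 < ε ∧ ε ≤ 1 ∧ ∃ᶠ n : ℕ in atTop, ε * n ≤ |d n| := by
    rw [Metric.tendsto_nhds] at hva
    push Not at hva
    obtain ⟨ε, hε0, hε⟩ := hva
    -- The cap at 1 keeps the bet size ε/4 admissible.
    refine ⟨min ε 1, lt_min hε0 one_pos, min_le_right _ _, ?_⟩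
    refine (hε.and_eventually (eventually_gt_atTop 0)).mono fun n hn => ?_
    have hn0 : (0 : ℝ) < n := by exact_mod_cast hn.2
    have h1 := hn.1
    rw [Real.dist_eq, sub_zero, abs_div, abs_of_pos hn0, le_div_iff₀ hn0] at h1
    exact (mul_le_mul_of_nonneg_right (min_le_left _ _) hn0.le).trans h1
  -- The sign of θ is one for which the deviation has that sign infinitely often.
  obtain ⟨θ, hθ, hfreq⟩ : ∃ θ : ℝ, |θ| = ε / 4 ∧ ∃ᶠ n : ℕ in atTop, ε ^ 2 / 4 * n ≤ θ * d n := by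
    have hor : ∃ᶠ n : ℕ in atTop, ε * n ≤ d n ∨ ε * n ≤ - d n :=
      hε.mono fun n hn => le_abs.1 hn
    rcases frequently_or_distrib.1 hor with h | h
    · exact ⟨ε / 4, abs_of_pos (by positivity), h.mono fun n hn => by nlinarith⟩
    · exact ⟨-(ε / 4), by rw [abs_neg, abs_of_pos (by positivity)], h.mono fun n hn => by nlinarith⟩
  have hθ2 : θ ^ 2 = ε ^ 2 / 16 := by rw [← sq_abs, hθ]; ring
  refine ⟨wordGambler hμ hsum v a θ (by linarith), ?_⟩
  filter_upwards [ProbGambler.ae_mem_support _] with ω hω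
  -- The gain ε²n/4 minus the loss 2θ²n = ε²n/8 leaves ε²n/8, which is at least ε²(n + |v|)/16 once
  -- n ≥ |v|.
  refine growsExponentiallyIO_of_frequently (s := ε ^ 2 / 16) (by positivity) ?_
  have hshift : ∃ᶠ n : ℕ in atTop, Real.exp (ε ^ 2 / 16 * (n + v.length : ℕ)) ≤
      (wordGambler hμ hsum v a θ (by linarith)).capital X ω (n + v.length) := by
    refine (hfreq.and_eventually (eventually_ge_atTop v.length)).mono fun n hn => ?_
    refine le_trans (Real.exp_le_exp.2 ?_) (exp_le_wordGambler_capital hμ hsum v a θ _ hω n)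
    have h1 : (v.length : ℝ) ≤ n := by exact_mod_cast hn.2
    have h2 := hn.1
    rw [hθ2]
    push_cast
    nlinarith [sq_nonneg ε]
  exact (tendsto_add_atTop_nat v.length).frequently hshift

theorem mainTheorem5 {A : Type u} [Fintype A] [DecidableEq A]
    (μ : A → ℝ) (hμ_pos : ∀ a, 0 < μ a) (hμ_sum : ∑ a, μ a = 1) (X : ℕ → A) :
    (IsNormalSeq μ X →
      ∀ G : ProbGambler.{u, v} A μ, ∀ᵐ ω ∂G.choiceMeasure,
        UltimatelyConstant (G.capital X ω) ∨ DecreasesExponentially (G.capital X ω)) ∧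
    (¬ IsNormalSeq μ X →
      ∃ G : ProbGambler.{u, 0} A μ, ∀ᵐ ω ∂G.choiceMeasure,
        GrowsExponentiallyIO (G.capital X ω)) := by
  exact ⟨fun hX G => G.ae_ultimatelyConstant_or_decreasesExponentially hμ_pos hμ_sum hX,
    exists_gambler_ae_growsExponentiallyIO hμ_pos hμ_sum⟩
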